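/- Let $\mathbb{D}=\{z\in\mathbb{C}:|z|<1\}$. For analytic functions $g_1,g_2$ on $\mathbb{D}$ write $g_1\prec g_2$ if there is an analytic function $w$ on $\mathbb{D}$ with $w(0)=0$ and $|w(z)|\le|z|$ such that $g_1(z)=g_2(w(z))$ for all $z\in\mathbb{D}$. Let $\mathcal{S}^*_\rho$ be the class of analytic functions $f(z)=z+\sum_{n=2}^{\infty}a_nz^n$ on $\mathbb{D}$ such that $$\frac{zf'(z)}{f(z)}\prec 1+\sinh^{-1}(z),$$ where $\sinh^{-1}z=\log\bigl(z+\sqrt{1+z^2}\bigr)$ is the principal branch and $zf'(z)/f(z)$ is given the value $1$ at $z=0$. For $q,n\ge 1$ let $H_{q,n}(f)=\det\bigl(a_{n+i+j}\bigr)_{0\le i,j<q}$ (with $a_1=1$), so that $H_{2,3}(f)=a_3a_5-a_4^2$. Then for every $f\in\mathcal{S}^*_\rho$, $$|H_{2,3}(f)|=|a_3a_5-a_4^2|\le 0.146048.$$ -/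

import Mathlib

namespace PetalStarlike

/-- The open unit disc in the complex plane. -/
abbrev unitDisc : Set ℂ := Metric.ball (0 : ℂ) 1

/-- The class of normalized analytic functions on the unit disc:
`f` is holomorphic on the disc, `f(0) = 0` and `f'(0) = 1`. Values of `f` outside the
open disc play no role. -/
structure IsNormalized (f : ℂ → ℂ) : Prop where
  differentiableOn : DifferentiableOn ℂ f unitDisc
  map_zero : f 0 = 0
  deriv_zero : deriv f 0 = 1

/-- Subordination `g₁ ≺ g₂` of analytic functions on the unit disc: `g₁ = g₂ ∘ w` on the disc for
some analytic `w` with `w(0) = 0` and `|w(z)| ≤ |z|`. -/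
def Subordinate (g₁ g₂ : ℂ → ℂ) : Prop :=
  DifferentiableOn ℂ g₁ unitDisc ∧ DifferentiableOn ℂ g₂ unitDisc ∧
    ∃ w : ℂ → ℂ, DifferentiableOn ℂ w unitDisc ∧ w 0 = 0 ∧
      (∀ z ∈ unitDisc, ‖w z‖ ≤ ‖z‖) ∧ ∀ z ∈ unitDisc, g₁ z = g₂ (w z)

/-- The principal branch of the complex inverse hyperbolic sine,
`sinh⁻¹ z = log (z + √(1 + z²))`, with cuts on the imaginary axis outside `[-i, i]`. -/
noncomputable def arsinh (z : ℂ) : ℂ :=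
  Complex.log (z + (1 + z ^ 2) ^ (1 / 2 : ℂ))

/-- The function `ρ(z) = 1 + sinh⁻¹ z`, which maps the unit disc onto a petal-shaped domain. -/
noncomputable def rho (z : ℂ) : ℂ := 1 + arsinh z

/-- The function `z f'(z) / f(z)`, with its removable singularity at the origin filled in by the
value `1` (the limit at `0` for a normalized `f`). -/
noncomputable def logDerivQuotient (f : ℂ → ℂ) (z : ℂ) : ℂ :=
  if z = 0 then 1 else z * deriv f z / f z

/-- The class `S*_ρ`: normalized analytic functions with `z f'(z) / f(z) ≺ 1 + sinh⁻¹ z`. -/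
def petalStarlike : Set (ℂ → ℂ) :=
  {f | IsNormalized f ∧ Subordinate (logDerivQuotient f) rho}

/-- The Taylor coefficient `aₙ` of `f` at the origin. -/
noncomputable def taylorCoeff (f : ℂ → ℂ) (n : ℕ) : ℂ :=
  iteratedDeriv n f 0 / (n.factorial : ℂ)

/-- The Hankel determinant `H_{q,n}(f)` of the `q × q` matrix with entries `a_{n+i+j}`,
`0 ≤ i, j < q`. -/
noncomputable def hankelDet (q n : ℕ) (f : ℂ → ℂ) : ℂ :=
  (Matrix.of fun i j : Fin q => taylorCoeff f (n + (i : ℕ) + (j : ℕ))).det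

theorem hankelDet_two_three (f : ℂ → ℂ) :
    hankelDet 2 3 f = taylorCoeff f 3 * taylorCoeff f 5 - taylorCoeff f 4 ^ 2 := by
  simp [hankelDet, Matrix.det_fin_two, pow_two]

theorem sqrt_sq (z : ℂ) : ((1 + z ^ 2) ^ (1 / 2 : ℂ)) ^ 2 = 1 + z ^ 2 := by
  have h := Complex.cpow_nat_inv_pow (1 + z ^ 2) (n := 2) two_ne_zero
  simpa using h

theorem arsinh_arg_mem_slitPlane (z : ℂ) :
    z + (1 + z ^ 2) ^ (1 / 2 : ℂ) ∈ Complex.slitPlane := by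
  set s := (1 + z ^ 2) ^ (1 / 2 : ℂ) with hs
  have hsq : s ^ 2 = 1 + z ^ 2 := sqrt_sq z
  have hre : 0 ≤ s.re := by
    by_cases h0 : 1 + z ^ 2 = 0
    · simp [hs, h0]
    · have habs : |(Complex.log (1 + z ^ 2) * (1 / 2 : ℂ)).im| ≤ Real.pi / 2 := by
        have him : (Complex.log (1 + z ^ 2) * (1 / 2 : ℂ)).im = Complex.arg (1 + z ^ 2) / 2 := by
          simp [Complex.mul_im, Complex.log_im]
          ring
        rw [him, abs_div, abs_two]
        have := Complex.abs_arg_le_pi (1 + z ^ 2)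
        linarith
      rw [hs, Complex.cpow_def_of_ne_zero h0, Complex.exp_re]
      exact mul_nonneg (Real.exp_pos _).le
        (Real.cos_nonneg_of_mem_Icc ⟨by linarith [(abs_le.1 habs).1], (abs_le.1 habs).2⟩)
  by_contra hn
  rw [Complex.mem_slitPlane_iff] at hn
  push Not at hn
  obtain ⟨h1, h2⟩ := hn
  have hprod : (z + s) * (s - z) = 1 := by linear_combination hsq
  have hr := congrArg Complex.re hprod
  simp only [Complex.mul_re, Complex.add_re, Complex.sub_re, Complex.one_re] at hr
  rw [h2, zero_mul, sub_zero] at hr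
  simp only [Complex.add_re] at h1
  nlinarith [sq_nonneg (z.re + s.re)]

/-- `arsinh` is a right inverse of `sinh`. -/
theorem sinh_arsinh (z : ℂ) : Complex.sinh (arsinh z) = z := by
  have hne := Complex.slitPlane_ne_zero (arsinh_arg_mem_slitPlane z)
  have hsq := sqrt_sq z
  rw [Complex.sinh, Complex.exp_neg, arsinh, Complex.exp_log hne]
  field_simp
  linear_combination hsq

theorem differentiableOn_rho : DifferentiableOn ℂ rho unitDisc := by
  intro z hz
  have hz1 : ‖z‖ < 1 := by simpa using hz
  have hmem : 1 + z ^ 2 ∈ Complex.slitPlane := by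
    rw [Complex.mem_slitPlane_iff]
    left
    have h1 : |(z ^ 2).re| ≤ ‖z ^ 2‖ := Complex.abs_re_le_norm _
    have h2 : ‖z ^ 2‖ < 1 := by
      rw [norm_pow]
      exact pow_lt_one₀ (norm_nonneg z) hz1 two_ne_zero
    have h3 := (abs_le.1 h1).1
    simp only [Complex.add_re, Complex.one_re]
    linarith
  have hs : DifferentiableAt ℂ (fun z : ℂ => (1 + z ^ 2) ^ (1 / 2 : ℂ)) z :=
    DifferentiableAt.cpow (by fun_prop) (by fun_prop) hmem
  exact ((differentiableAt_const _).add
    ((differentiableAt_id.add hs).clog (arsinh_arg_mem_slitPlane z))).differentiableWithinAt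

/-- The identity belongs to the class, with the zero function as Schwarz function. -/
theorem id_mem_petalStarlike : (fun z : ℂ => z) ∈ petalStarlike := by
  have hq : logDerivQuotient (fun z : ℂ => z) = fun _ => 1 := by
    funext z
    by_cases h : z = 0
    · simp [logDerivQuotient, h]
    · simp [logDerivQuotient, h]
  refine ⟨⟨differentiableOn_id, rfl, by simp⟩, ?_, differentiableOn_rho, fun _ => 0, ?_, rfl, ?_, ?_⟩
  · rw [hq]
    exact differentiableOn_const _
  · exact differentiableOn_const _
  · intro z _
    simp
  · intro z _
    rw [hq]
    simp [rho, arsinh]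

end PetalStarlike

namespace PetalStarlike

/-! Write P = zf'/f = 1 + arsinh ∘ w with w the Schwarz function. Since sinh inverts arsinh, w =
sinh(P - 1) near 0, so the coefficients of P are solved from those of w without expanding the
logarithm. Comparing coefficients in zf' = P f then makes the Hankel determinant an explicit
polynomial in w₁, ..., w₄ (`hankelDet_eq_of_mem`).

The only further information needed about w is the Bessel bound |w₁|² + |w₂|² + |w₃|² + |w₄|² ≤ 1
(`sum_sq_norm_taylorCoeff_le_one`). The triangle inequality replaces the polynomial by a real
majorant in c, u, v, t = |w₁|, ..., |w₄|, and `majorant_le` bounds it on the unit ball by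
eliminating t, v and u in turn and covering the range of c² by seven intervals. -/

/-! ### The real majorant on the unit ball. -/

/-- A weighted arithmetic-geometric mean estimate for the majorant of the Hankel determinant,
eliminating the third and fourth variables. -/
theorem majorant_le_of_weight {c u v t l : ℝ} (hl : 1 / 9 < l)
    (h : c ^ 2 + u ^ 2 + v ^ 2 + t ^ 2 ≤ 1) :
    v ^ 2 / 9 + (c * u / 6 + 5 * c ^ 3 / 54) * v + (u + c ^ 2) * t / 8 ≤
      l * (1 - c ^ 2 - u ^ 2) + (c * u / 6 + 5 * c ^ 3 / 54) ^ 2 / (4 * (l - 1 / 9)) +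
        (u + c ^ 2) ^ 2 / (256 * l) := by
  have amgm : ∀ {k x y : ℝ}, 0 < k → x * y ≤ k * y ^ 2 + x ^ 2 / (4 * k) := by
    intro k x y hk
    have : k * y ^ 2 + x ^ 2 / (4 * k) - x * y = (2 * k * y - x) ^ 2 / (4 * k) := by
      field_simp
      ring
    have := div_nonneg (sq_nonneg (2 * k * y - x)) (by linarith : 0 ≤ 4 * k)
    linarith
  have h1 := amgm (k := l - 1 / 9) (x := c * u / 6 + 5 * c ^ 3 / 54) (y := v) (by linarith)
  have h2 := amgm (k := l) (x := (u + c ^ 2) / 8) (y := t) (by linarith)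
  have h3 : ((u + c ^ 2) / 8) ^ 2 / (4 * l) = (u + c ^ 2) ^ 2 / (256 * l) := by
    field_simp
    ring
  have h4 := mul_le_mul_of_nonneg_left h (by linarith : 0 ≤ l)
  linarith

/-- Reduction of the majorant estimate to two one-variable polynomial inequalities in `c ^ 2`. -/
theorem majorant_le_of_params {c u v t : ℝ} (l m d : ℝ) (hl : 1 / 9 < l) (hm : 0 < m)
    (hud : u ≤ d) (h : c ^ 2 + u ^ 2 + v ^ 2 + t ^ 2 ≤ 1)
    (hA : ((c ^ 2) ^ 2 / 18 + 5 * (c ^ 2) ^ 2 / (648 * (l - 1 / 9)) + c ^ 2 / (128 * l)) / (2 * m) ≤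
      l - c ^ 2 / 8 - c ^ 2 / (144 * (l - 1 / 9)) - 1 / (256 * l) - d / 16)
    (hD : ((c ^ 2) ^ 2 / 18 + 5 * (c ^ 2) ^ 2 / (648 * (l - 1 / 9)) + c ^ 2 / (128 * l)) * m / 2 ≤
      0.146048 - l * (1 - c ^ 2) - 25 * (c ^ 2) ^ 3 / 1296 -
        25 * (c ^ 2) ^ 3 / (11664 * (l - 1 / 9)) - (c ^ 2) ^ 2 / (256 * l)) :
    (u + c ^ 2) * t / 8 + v ^ 2 / 9 + c * u * v / 6 + 5 * c ^ 3 * v / 54 + u ^ 3 / 16 +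
      c ^ 2 * u ^ 2 / 8 + c ^ 4 * u / 18 + 25 * c ^ 6 / 1296 ≤ 0.146048 := by
  have h1 := majorant_le_of_weight hl h
  set B := (c ^ 2) ^ 2 / 18 + 5 * (c ^ 2) ^ 2 / (648 * (l - 1 / 9)) + c ^ 2 / (128 * l) with hB
  have hk : 0 < l - 1 / 9 := by linarith
  have hB0 : 0 ≤ B := by positivity
  -- The cubic term is absorbed into the u² terms, so the bound becomes a quadratic in u with linear
  -- coefficient B.
  have h2 : u ^ 3 / 16 ≤ d * u ^ 2 / 16 := by nlinarith [mul_le_mul_of_nonneg_right hud (sq_nonneg u)]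
  have h3 := mul_le_mul_of_nonneg_right hA (sq_nonneg u)
  -- Tangent at u = m. Now `hA` makes the total u² coefficient nonpositive and `hD` bounds what is
  -- left.
  have h4 : B * u ≤ B / (2 * m) * u ^ 2 + B * m / 2 := by
    have : B / (2 * m) * u ^ 2 + B * m / 2 - B * u = B * (u - m) ^ 2 / (2 * m) := by
      field_simp
      ring
    have := div_nonneg (mul_nonneg hB0 (sq_nonneg (u - m))) (by linarith : 0 ≤ 2 * m)
    linarith
  have h5 : (c * u / 6 + 5 * c ^ 3 / 54) ^ 2 / (4 * (l - 1 / 9)) =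
      c ^ 2 / (144 * (l - 1 / 9)) * u ^ 2 + 5 * (c ^ 2) ^ 2 / (648 * (l - 1 / 9)) * u +
        25 * (c ^ 2) ^ 3 / (11664 * (l - 1 / 9)) := by
    generalize l - 1 / 9 = k at hk ⊢
    field_simp
    ring
  have h6 : (u + c ^ 2) ^ 2 / (256 * l) =
      1 / (256 * l) * u ^ 2 + c ^ 2 / (128 * l) * u + (c ^ 2) ^ 2 / (256 * l) := by
    have : 0 < l := by linarith
    field_simp
    ring
  have h7 : B * u = (c ^ 2) ^ 2 / 18 * u + 5 * (c ^ 2) ^ 2 / (648 * (l - 1 / 9)) * u +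
      c ^ 2 / (128 * l) * u := by rw [hB]; ring
  nlinarith [h1, h2, h3, h4, h5, h6, h7]

/-- On each interval for c², suitable parameters l, m, d reduce the claim to inequalities with
nonnegative weights on c⁴ and c⁶; bounding these powers by their chords leaves checks linear in c².
-/
theorem majorant_le {c u v t : ℝ} (h : c ^ 2 + u ^ 2 + v ^ 2 + t ^ 2 ≤ 1) :
    (u + c ^ 2) * t / 8 + v ^ 2 / 9 + c * u * v / 6 + 5 * c ^ 3 * v / 54 + u ^ 3 / 16 +
      c ^ 2 * u ^ 2 / 8 + c ^ 4 * u / 18 + 25 * c ^ 6 / 1296 ≤ 0.146048 := by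
  -- Chord bounds for x² and x³ on [a, b] at x = c², while u² ≤ 1 - a gives u ≤ d.
  have key : ∀ a b d : ℝ, 0 ≤ a → a ≤ c ^ 2 → c ^ 2 ≤ b → 0 ≤ d → 1 - a ≤ d ^ 2 →
      u ≤ d ∧ (c ^ 2) ^ 2 ≤ (a + b) * c ^ 2 - a * b ∧
        (c ^ 2) ^ 3 ≤ (a ^ 2 + a * b + b ^ 2) * c ^ 2 - a * b * (a + b) := by
    intro a b d ha hac hcb hd0 hd
    have h1 := mul_nonneg (sub_nonneg.2 hac) (sub_nonneg.2 hcb)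
    have h2 := mul_nonneg (by linarith : 0 ≤ c ^ 2 + a + b) h1
    refine ⟨abs_le_of_sq_le_sq' (by nlinarith [sq_nonneg v, sq_nonneg t]) hd0 |>.2,
      by linarith, by linarith⟩
  have hc0 := sq_nonneg c
  have hc1 : c ^ 2 ≤ 1 := by nlinarith [sq_nonneg u, sq_nonneg v, sq_nonneg t]
  -- At c = 0 the condition `hD` says l ≤ 0.146048, hence l = 0.145 on the first interval.
  rcases le_total (c ^ 2) 0.14 with h0 | h0
  · obtain ⟨hd, hq, hr⟩ := key 0 0.14 1 (by norm_num) hc0 h0 (by norm_num) (by norm_num)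
    apply majorant_le_of_params 0.145 0.9 1 (by norm_num) (by norm_num) hd h <;>
      norm_num at hq hr ⊢ <;> linarith
  rcases le_total (c ^ 2) 0.24 with h1 | h1
  · obtain ⟨hd, hq, hr⟩ := key 0.14 0.24 0.93 (by norm_num) h0 h1 (by norm_num) (by norm_num)
    apply majorant_le_of_params 0.16 1.1 0.93 (by norm_num) (by norm_num) hd h <;>
      norm_num at hq hr ⊢ <;> linarith
  rcases le_total (c ^ 2) 0.34 with h2 | h2
  · obtain ⟨hd, hq, hr⟩ := key 0.24 0.34 0.88 (by norm_num) h1 h2 (by norm_num) (by norm_num)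
    apply majorant_le_of_params 0.18 0.7 0.88 (by norm_num) (by norm_num) hd h <;>
      norm_num at hq hr ⊢ <;> linarith
  rcases le_total (c ^ 2) 0.45 with h3 | h3
  · obtain ⟨hd, hq, hr⟩ := key 0.34 0.45 0.82 (by norm_num) h2 h3 (by norm_num) (by norm_num)
    apply majorant_le_of_params 0.195 0.8 0.82 (by norm_num) (by norm_num) hd h <;>
      norm_num at hq hr ⊢ <;> linarith
  rcases le_total (c ^ 2) 0.6 with h4 | h4
  · obtain ⟨hd, hq, hr⟩ := key 0.45 0.6 0.75 (by norm_num) h3 h4 (by norm_num) (by norm_num)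
    apply majorant_le_of_params 0.225 0.7 0.75 (by norm_num) (by norm_num) hd h <;>
      norm_num at hq hr ⊢ <;> linarith
  rcases le_total (c ^ 2) 0.94 with h5 | h5
  · obtain ⟨hd, hq, hr⟩ := key 0.6 0.94 0.64 (by norm_num) h4 h5 (by norm_num) (by norm_num)
    apply majorant_le_of_params 0.29 0.7 0.64 (by norm_num) (by norm_num) hd h <;>
      norm_num at hq hr ⊢ <;> linarith
  obtain ⟨hd, hq, hr⟩ := key 0.94 1 0.25 (by norm_num) h5 hc1 (by norm_num) (by norm_num)
  apply majorant_le_of_params 0.265 1.1 0.25 (by norm_num) (by norm_num) hd h <;>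
    norm_num at hq hr ⊢ <;> linarith

/-! ### Bessel's inequality for Taylor coefficients. -/

/-- Cauchy's integral formula on |z| = r, parametrized by the angle. -/
theorem fourierCoeffOn_circleMap {w : ℂ → ℂ} (hw : DifferentiableOn ℂ w unitDisc) {r : ℝ}
    (hr0 : 0 < r) (hr1 : r < 1) (n : ℕ) :
    fourierCoeffOn Real.two_pi_pos (fun θ => w (circleMap 0 r θ)) (n : ℤ) =
      (r : ℂ) ^ n * taylorCoeff w n := by
  have hc := (hw.mono (Metric.closedBall_subset_ball hr1)).circleIntegral_one_div_sub_center_pow_smul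
    hr0 n
  have hr : (r : ℂ) ≠ 0 := by exact_mod_cast hr0.ne'
  have hpi : (Real.pi : ℂ) ≠ 0 := by exact_mod_cast Real.pi_ne_zero
  have hI : (2 * Real.pi * Complex.I : ℂ) * taylorCoeff w n =
      ∫ θ in (0 : ℝ)..2 * Real.pi, (Complex.I * ((r : ℂ) ^ n)⁻¹) *
        (fourier (-(n : ℤ)) (θ : AddCircle (2 * Real.pi - 0)) • w (circleMap 0 r θ)) := by
    have hlhs : (2 * Real.pi * Complex.I : ℂ) * taylorCoeff w n =
        (2 * Real.pi * Complex.I / n.factorial : ℂ) • iteratedDeriv n w 0 := by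
      simp only [taylorCoeff, smul_eq_mul]
      ring
    rw [hlhs, ← hc, circleIntegral]
    refine intervalIntegral.integral_congr fun θ _ => ?_
    have he : Complex.exp (θ * Complex.I) ≠ 0 := Complex.exp_ne_zero _
    have hf : (fourier (-(n : ℤ)) (θ : AddCircle (2 * Real.pi - 0)) : ℂ) =
        (Complex.exp (θ * Complex.I) ^ n)⁻¹ := by
      rw [fourier_coe_apply, ← Complex.exp_nat_mul, ← Complex.exp_neg]
      congr 1
      push_cast
      field_simp
      ring
    simp only [hf, deriv_circleMap, smul_eq_mul, sub_zero, circleMap_zero]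
    field_simp
    ring
  rw [fourierCoeffOn_eq_integral]
  rw [intervalIntegral.integral_const_mul] at hI
  have h2 : (∫ θ in (0 : ℝ)..2 * Real.pi,
      fourier (-(n : ℤ)) (θ : AddCircle (2 * Real.pi - 0)) • w (circleMap 0 r θ)) =
      2 * Real.pi * ((r : ℂ) ^ n * taylorCoeff w n) := by
    field_simp at hI
    linear_combination -hI
  rw [h2, Complex.real_smul]
  push_cast
  field_simp
  simp

/-- Bessel's inequality for the Taylor coefficients of a bounded function on the disc. -/
theorem sum_sq_norm_taylorCoeff_le_one {w : ℂ → ℂ} (hw : DifferentiableOn ℂ w unitDisc)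
    (hb : ∀ z ∈ unitDisc, ‖w z‖ ≤ 1) (s : Finset ℕ) :
    ∑ n ∈ s, ‖taylorCoeff w n‖ ^ 2 ≤ 1 := by
  have key : ∀ r : ℝ, 0 < r → r < 1 → ∑ n ∈ s, (r ^ n * ‖taylorCoeff w n‖) ^ 2 ≤ 1 := by
    intro r hr0 hr1
    have hmem : ∀ θ, circleMap 0 r θ ∈ unitDisc := fun θ => by
      simp [abs_of_pos hr0, hr1]
    have hcont : Continuous fun θ => w (circleMap 0 r θ) :=
      hw.continuousOn.comp_continuous (continuous_circleMap 0 r) hmem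
    have hL : MeasureTheory.MemLp (fun θ => w (circleMap 0 r θ)) 2
        (MeasureTheory.volume.restrict (Set.Ioc 0 (2 * Real.pi))) :=
      MeasureTheory.MemLp.of_bound hcont.aestronglyMeasurable 1
        (Filter.Eventually.of_forall fun θ => hb _ (hmem θ))
    have hs := hasSum_sq_fourierCoeffOn Real.two_pi_pos hL
    -- Parseval on |z| = r, keeping only finitely many nonnegative frequencies.
    have h1 := sum_le_hasSum (s.map Nat.castEmbedding) (fun _ _ => sq_nonneg _) hs
    have h2 : (∫ θ in (0 : ℝ)..2 * Real.pi, ‖w (circleMap 0 r θ)‖ ^ 2) ≤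
        ∫ _ in (0 : ℝ)..2 * Real.pi, (1 : ℝ) := by
      refine intervalIntegral.integral_mono Real.two_pi_pos.le
        ((hcont.norm.pow 2).intervalIntegrable _ _) (by simp) fun θ => ?_
      exact pow_le_one₀ (norm_nonneg _) (hb _ (hmem θ))
    rw [Finset.sum_map] at h1
    simp only [Nat.castEmbedding_apply, fourierCoeffOn_circleMap hw hr0 hr1, norm_mul, norm_pow,
      Complex.norm_real, Real.norm_of_nonneg hr0.le] at h1
    refine h1.trans ?_
    rw [smul_eq_mul, inv_mul_le_iff₀ (by linarith [Real.pi_pos])]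
    simpa using h2
  -- Letting r → 1 from below removes the factors rⁿ.
  have hlim : Filter.Tendsto (fun r : ℝ => ∑ n ∈ s, (r ^ n * ‖taylorCoeff w n‖) ^ 2)
      (nhdsWithin 1 (Set.Iio 1)) (nhds (∑ n ∈ s, ((1 : ℝ) ^ n * ‖taylorCoeff w n‖) ^ 2)) :=
    Filter.Tendsto.mono_left (Continuous.tendsto (by fun_prop) 1) nhdsWithin_le_nhds
  have := le_of_tendsto hlim (b := 1) (by
    filter_upwards [Ioo_mem_nhdsLT (zero_lt_one' ℝ)] with r hr
    exact key r hr.1 hr.2)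
  simpa using this

/-! ### Calculus of Taylor coefficients. -/

theorem taylorCoeff_congr {f g : ℂ → ℂ} (h : f =ᶠ[nhds 0] g) (n : ℕ) :
    taylorCoeff f n = taylorCoeff g n := by
  rw [taylorCoeff, taylorCoeff, h.iteratedDeriv_eq]

theorem taylorCoeff_zero (f : ℂ → ℂ) : taylorCoeff f 0 = f 0 := by
  simp [taylorCoeff]

theorem taylorCoeff_deriv (f : ℂ → ℂ) (n : ℕ) :
    taylorCoeff (deriv f) n = (n + 1) * taylorCoeff f (n + 1) := by
  have : (n.factorial : ℂ) ≠ 0 := by exact_mod_cast n.factorial_ne_zero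
  have : (n + 1 : ℂ) ≠ 0 := by exact_mod_cast n.succ_ne_zero
  rw [taylorCoeff, taylorCoeff, iteratedDeriv_succ', Nat.factorial_succ]
  push_cast
  field_simp

/-- The Cauchy product formula for Taylor coefficients. -/
theorem taylorCoeff_mul {f g : ℂ → ℂ} (hf : AnalyticAt ℂ f 0) (hg : AnalyticAt ℂ g 0) (n : ℕ) :
    taylorCoeff (fun z => f z * g z) n =
      ∑ i ∈ Finset.range (n + 1), taylorCoeff f i * taylorCoeff g (n - i) := by
  rw [taylorCoeff, iteratedDeriv_fun_mul hf.contDiffAt hg.contDiffAt, Finset.sum_div]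
  refine Finset.sum_congr rfl fun i hi => ?_
  have hin : i ≤ n := Nat.lt_succ_iff.1 (Finset.mem_range.1 hi)
  have h1 : (i.factorial : ℂ) ≠ 0 := by exact_mod_cast i.factorial_ne_zero
  have h2 : ((n - i).factorial : ℂ) ≠ 0 := by exact_mod_cast (n - i).factorial_ne_zero
  have h3 : (n.factorial : ℂ) ≠ 0 := by exact_mod_cast n.factorial_ne_zero
  have h4 : (n.choose i : ℂ) * i.factorial * (n - i).factorial = n.factorial := by
    exact_mod_cast Nat.choose_mul_factorial_mul_factorial hin
  rw [taylorCoeff, taylorCoeff, ← h4]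
  rw [← h4] at h3
  have h5 : (n.choose i : ℂ) ≠ 0 := fun h => h3 (by simp [h])
  field_simp

theorem taylorCoeff_id_mul_deriv {f : ℂ → ℂ} (hf : AnalyticAt ℂ f 0) (n : ℕ) :
    taylorCoeff (fun z => z * deriv f z) n = n * taylorCoeff f n := by
  rw [taylorCoeff_mul (f := fun z => z) analyticAt_id hf.deriv]
  have h : ∀ i, taylorCoeff (fun z => z) i = if i = 1 then 1 else 0 := by
    intro i
    rw [taylorCoeff, iteratedDeriv_fun_id_zero]
    split_ifs with hi <;> simp [hi]
  rcases n with _ | n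
  · simp [h]
  · rw [Finset.sum_eq_single 1]
    · simp [h, taylorCoeff_deriv]
    · intro i _ hi
      simp [h, hi]
    · intro hi
      simp at hi

/-- Coefficients of `sinh ∘ g` up to order four, for `g` vanishing at the origin. -/
theorem taylorCoeff_sinh {g : ℂ → ℂ} (hg : AnalyticAt ℂ g 0) (h0 : g 0 = 0) :
    taylorCoeff (fun z => Complex.sinh (g z)) 1 = taylorCoeff g 1 ∧
    taylorCoeff (fun z => Complex.sinh (g z)) 2 = taylorCoeff g 2 ∧
    taylorCoeff (fun z => Complex.sinh (g z)) 3 = taylorCoeff g 3 + taylorCoeff g 1 ^ 3 / 6 ∧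
    taylorCoeff (fun z => Complex.sinh (g z)) 4 =
      taylorCoeff g 4 + taylorCoeff g 1 ^ 2 * taylorCoeff g 2 / 2 := by
  set S : ℂ → ℂ := fun z => Complex.sinh (g z) with hS
  set C : ℂ → ℂ := fun z => Complex.cosh (g z) with hC
  have hSa : AnalyticAt ℂ S 0 :=
    (Complex.differentiable_sinh.analyticAt _).comp hg
  have hCa : AnalyticAt ℂ C 0 :=
    (Complex.differentiable_cosh.analyticAt _).comp hg
  -- The system S' = C g', C' = S g' yields coupled recursions for the coefficients of sinh ∘ g and
  -- cosh ∘ g.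
  have hdS : deriv S =ᶠ[nhds 0] fun z => C z * deriv g z := by
    filter_upwards [hg.eventually_analyticAt] with z hz
    exact (hz.differentiableAt.hasDerivAt.csinh).deriv
  have hdC : deriv C =ᶠ[nhds 0] fun z => S z * deriv g z := by
    filter_upwards [hg.eventually_analyticAt] with z hz
    exact (hz.differentiableAt.hasDerivAt.ccosh).deriv
  have hS0 : taylorCoeff S 0 = 0 := by simp [taylorCoeff_zero, hS, h0]
  have hC0 : taylorCoeff C 0 = 1 := by simp [taylorCoeff_zero, hC, h0]
  have rS : ∀ n : ℕ, (n + 1) * taylorCoeff S (n + 1) = ∑ i ∈ Finset.range (n + 1),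
      taylorCoeff C i * (((n - i : ℕ) + 1) * taylorCoeff g ((n - i) + 1)) := by
    intro n
    rw [← taylorCoeff_deriv, taylorCoeff_congr hdS, taylorCoeff_mul hCa hg.deriv]
    simp only [taylorCoeff_deriv]
  have rC : ∀ n : ℕ, (n + 1) * taylorCoeff C (n + 1) = ∑ i ∈ Finset.range (n + 1),
      taylorCoeff S i * (((n - i : ℕ) + 1) * taylorCoeff g ((n - i) + 1)) := by
    intro n
    rw [← taylorCoeff_deriv, taylorCoeff_congr hdC, taylorCoeff_mul hSa hg.deriv]
    simp only [taylorCoeff_deriv]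
  have s1 := rS 0
  have s2 := rS 1
  have s3 := rS 2
  have s4 := rS 3
  have c1 := rC 0
  have c2 := rC 1
  have c3 := rC 2
  simp [hS0, hC0] at s1 c1
  simp [Finset.sum_range_succ, hS0, hC0, c1, s1] at s2 c2
  norm_num at s2 c2
  have c2' : taylorCoeff C 2 = taylorCoeff g 1 ^ 2 / 2 := by linear_combination c2 / 2
  have s2' : taylorCoeff S 2 = taylorCoeff g 2 := by linear_combination s2
  simp [Finset.sum_range_succ, hS0, hC0, c1, s1, c2', s2'] at s3 c3
  norm_num at s3 c3
  have c3' : taylorCoeff C 3 = taylorCoeff g 1 * taylorCoeff g 2 := by linear_combination c3 / 3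
  simp [Finset.sum_range_succ, hC0, c1, c2', c3'] at s4
  norm_num at s4
  refine ⟨s1, s2', ?_, ?_⟩
  · linear_combination s3 / 3
  · linear_combination s4 / 4

/-! ### The Hankel determinant in Schwarz coefficients. -/

/-- The Hankel determinant of a function in the class, in terms of the Taylor coefficients of a
Schwarz function. -/
theorem hankelDet_eq_of_mem {f w : ℂ → ℂ} (hf : IsNormalized f)
    (hP : DifferentiableOn ℂ (logDerivQuotient f) unitDisc)
    (hPw : ∀ z ∈ unitDisc, logDerivQuotient f z = rho (w z)) :
    hankelDet 2 3 f =
      (taylorCoeff w 2 + taylorCoeff w 1 ^ 2) * taylorCoeff w 4 / 8 - taylorCoeff w 3 ^ 2 / 9 -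
        taylorCoeff w 1 * taylorCoeff w 2 * taylorCoeff w 3 / 6 +
        5 * taylorCoeff w 1 ^ 3 * taylorCoeff w 3 / 54 + taylorCoeff w 2 ^ 3 / 16 -
        taylorCoeff w 1 ^ 2 * taylorCoeff w 2 ^ 2 / 8 -
        taylorCoeff w 1 ^ 4 * taylorCoeff w 2 / 18 - 25 * taylorCoeff w 1 ^ 6 / 1296 := by
  set P := logDerivQuotient f with hPdef
  have hD : unitDisc ∈ nhds (0 : ℂ) := Metric.ball_mem_nhds 0 one_pos
  have hfa : AnalyticAt ℂ f 0 := hf.differentiableOn.analyticAt hD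
  have hPa : AnalyticAt ℂ P 0 := hP.analyticAt hD
  have hP0 : P 0 = 1 := by simp [hPdef, logDerivQuotient]
  have hga : AnalyticAt ℂ (fun z => P z - 1) 0 := hPa.sub analyticAt_const
  have hsinh : w =ᶠ[nhds 0] fun z => Complex.sinh (P z - 1) := by
    filter_upwards [hD] with z hz
    rw [hPw z hz, rho, add_sub_cancel_left, sinh_arsinh]
  have hgP : ∀ n : ℕ, taylorCoeff (fun z => P z - 1) (n + 1) = taylorCoeff P (n + 1) := by
    intro n
    rw [taylorCoeff, taylorCoeff, iteratedDeriv_succ', iteratedDeriv_succ']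
    simp [deriv_sub_const_fun]
  -- The zero of f at 0 is isolated because f'(0) = 1, so the quotient P may be cleared near 0.
  have hne : ∀ᶠ z in nhds (0 : ℂ), z ≠ 0 → f z ≠ 0 := by
    have hd : HasDerivAt f 1 0 := hf.deriv_zero ▸ hfa.differentiableAt.hasDerivAt
    have := hd.eventually_ne (c := 0) one_ne_zero
    rwa [eventually_nhdsWithin_iff] at this
  have hode : (fun z => z * deriv f z) =ᶠ[nhds 0] fun z => P z * f z := by
    filter_upwards [hne] with z hz
    by_cases h : z = 0
    · simp [h, hf.map_zero]
    · simp [hPdef, logDerivQuotient, h, hz h]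
  have hrec : ∀ n : ℕ, n * taylorCoeff f n =
      ∑ i ∈ Finset.range (n + 1), taylorCoeff P i * taylorCoeff f (n - i) := by
    intro n
    rw [← taylorCoeff_id_mul_deriv hfa, taylorCoeff_congr hode, taylorCoeff_mul hPa hfa]
  have f0 : taylorCoeff f 0 = 0 := by rw [taylorCoeff_zero, hf.map_zero]
  have f1 : taylorCoeff f 1 = 1 := by simp [taylorCoeff, hf.deriv_zero]
  have p0 : taylorCoeff P 0 = 1 := by rw [taylorCoeff_zero, hP0]
  obtain ⟨w1, w2, w3, w4⟩ := taylorCoeff_sinh hga (by simp [hP0])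
  simp only [← taylorCoeff_congr hsinh, hgP 0, hgP 1, hgP 2, hgP 3, zero_add, Nat.reduceAdd]
    at w1 w2 w3 w4
  have r2 := hrec 2
  have r3 := hrec 3
  have r4 := hrec 4
  have r5 := hrec 5
  simp [Finset.sum_range_succ, f0, f1, p0] at r2 r3 r4 r5
  have a2 : taylorCoeff f 2 = taylorCoeff P 1 := by linear_combination r2
  have a3 : taylorCoeff f 3 = (taylorCoeff P 2 + taylorCoeff P 1 ^ 2) / 2 := by
    rw [a2] at r3
    linear_combination r3 / 2
  have a4 : taylorCoeff f 4 = (taylorCoeff P 3 + 3 / 2 * taylorCoeff P 1 * taylorCoeff P 2 +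
      taylorCoeff P 1 ^ 3 / 2) / 3 := by
    rw [a3, a2] at r4
    linear_combination r4 / 3
  have a5 : taylorCoeff f 5 = (taylorCoeff P 4 + taylorCoeff P 3 * taylorCoeff P 1 +
      taylorCoeff P 2 * taylorCoeff f 3 + taylorCoeff P 1 * taylorCoeff f 4) / 4 := by
    rw [a2] at r5
    linear_combination r5 / 4
  rw [hankelDet_two_three, a5, a4, a3, w1, w2, w3, w4]
  ring

/-- The triangle inequality for the Hankel determinant written in Schwarz coefficients. -/
theorem norm_hankel_polynomial_le (a b x y : ℂ) :
    ‖(b + a ^ 2) * y / 8 - x ^ 2 / 9 - a * b * x / 6 + 5 * a ^ 3 * x / 54 + b ^ 3 / 16 -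
      a ^ 2 * b ^ 2 / 8 - a ^ 4 * b / 18 - 25 * a ^ 6 / 1296‖ ≤
    (‖b‖ + ‖a‖ ^ 2) * ‖y‖ / 8 + ‖x‖ ^ 2 / 9 + ‖a‖ * ‖b‖ * ‖x‖ / 6 + 5 * ‖a‖ ^ 3 * ‖x‖ / 54 +
      ‖b‖ ^ 3 / 16 + ‖a‖ ^ 2 * ‖b‖ ^ 2 / 8 + ‖a‖ ^ 4 * ‖b‖ / 18 + 25 * ‖a‖ ^ 6 / 1296 := by
  have h1 : ‖(b + a ^ 2) * y / 8‖ ≤ (‖b‖ + ‖a‖ ^ 2) * ‖y‖ / 8 := by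
    rw [norm_div, norm_mul, Complex.norm_ofNat]
    gcongr
    exact norm_pow a 2 ▸ norm_add_le b (a ^ 2)
  refine (norm_sub_le _ _).trans (add_le_add ?_ (by simp))
  refine (norm_sub_le _ _).trans (add_le_add ?_ (by simp))
  refine (norm_sub_le _ _).trans (add_le_add ?_ (by simp))
  refine (norm_add_le _ _).trans (add_le_add ?_ (by simp))
  refine (norm_add_le _ _).trans (add_le_add ?_ (by simp))
  refine (norm_sub_le _ _).trans (add_le_add ?_ (by simp))
  exact (norm_sub_le _ _).trans (add_le_add h1 (by simp))

end PetalStarlike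

theorem mainTheorem6 (f : ℂ → ℂ) (hf : f ∈ PetalStarlike.petalStarlike) :
    ‖PetalStarlike.hankelDet 2 3 f‖ ≤ (0.146048 : ℝ) := by
  obtain ⟨hfn, hP, -, w, hw, -, hwz, hPw⟩ := hf
  have hb : ∀ z ∈ PetalStarlike.unitDisc, ‖w z‖ ≤ 1 := fun z hz =>
    (hwz z hz).trans (mem_ball_zero_iff.1 hz).le
  have hs := PetalStarlike.sum_sq_norm_taylorCoeff_le_one hw hb {1, 2, 3, 4}
  simp only [Finset.mem_insert, Finset.mem_singleton, OfNat.one_ne_ofNat, Nat.reduceEqDiff,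
    or_self, not_false_eq_true, Finset.sum_insert, Finset.sum_singleton] at hs
  rw [PetalStarlike.hankelDet_eq_of_mem hfn hP hPw]
  exact (PetalStarlike.norm_hankel_polynomial_le _ _ _ _).trans
    (PetalStarlike.majorant_le (by linarith))
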